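/- Setting. Let $\mathbb D\subset\mathbb R^q$ be compact, $\mathrm P_d$ a Borel probability measure on $\mathbb D$, $f:\mathbb R^n\times\mathbb D\to\mathbb R^n$ continuous, $\mathbb X\subset\mathbb R^n$ compact, and $\widehat{\mathbb X}\subset\mathbb R^n$ a compact set containing $\mathbb X$ and $\{f(x,d): x\in\mathbb X, d\in\mathbb D\}$. Let $h:\mathbb R^m\times\mathbb R^n\to\mathbb R$ be Borel measurable with $h(0,\cdot)\equiv 0$, let $\gamma,\epsilon,\delta\in(0,1)$, $U_a>0$, and let $x_1',\dots,x_{N_o}'\in\mathbb X$ with $N_o\ge 1$. For samples $D^M=(d^{(1)},\dots,d^{(M)})\in\mathbb D^M$, consider the sample-based robust barrier program $$\min_{a\in\mathbb R^m}\; -\frac1{N_o}\sum_{i=1}^{N_o}h(a,x_i')\quad\text{s.t.}\quad \begin{cases} h(a,x)\le 0 & \forall x\in\overline{\widehat{\mathbb X}\setminus\mathbb X},\\ h(a,f(x,d^{(j)}))\ge\gamma h(a,x) & \forall x\in\mathbb X,\ j=1,\dots,M,\\ a[l]\in[-U_a,U_a] & l=1,\dots,m.\end{cases}$$ For $x\in\mathbb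 X$ let $\mathbb F_x$ be the class of violation indicators $d\mapsto \mathbf 1\{h(a,f(x,d))-\gamma h(a,x)<0\}$ on $\mathbb D$, $a\in[-U_a,U_a]^m$, and assume that $\mathbb F_x$ has VC dimension at most $N\in\mathbb N$ for every $x\in\mathbb X$. Theorem (State-pointwise PAC one-step safety guarantee I). Let $d^{(1)},\dots,d^{(M)}$ be i.i.d. with law $\mathrm P_d$, and let $a^*=a^*(D^M)$ be a (measurably chosen) locally or globally optimal solution of the program. Put $\mathbb X_s=\{x\in\mathbb X: h(a^*(D^M),x)>0\}$. If $$M\ \ge\ \frac5\epsilon\Big(\ln\frac4\delta+N\ln\frac{40}\epsilon\Big),$$ then for each fixed $x\in\mathbb X$ $$\mathrm P_d^M\Big[\ \mathbb X_s\ne\emptyset\ \Rightarrow\ \mathrm P_d\big[h(a^*(D^M),f(x,d))\ge\gamma\,h(a^*(D^M),x)\big]\ge 1-\epsilon\ \Big]\ \ge\ 1-\delta ,$$ and consequently $$\mathrm P_d^M\Big[\ \mathbb X_s\ne\emptyset\ \Rightarrow\ \mathrm P_d\big[f(x,d)\in\mathbb X_s\big]\ge 1-\epsilon(x)\ \Big]\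 \ge\ 1-\delta ,$$ where $\epsilon(x)=\epsilon$ if $x\in\mathbb X_s$ and $\epsilon(x)=1$ if $x\in\mathbb X\setminus\mathbb X_s$. (If one of these events is not measurable, the claim is that it contains a measurable event of probability at least $1-\delta$.) -/

import Mathlib

open MeasureTheory

/-- `ℝᵏ`. -/
abbrev Vec (k : ℕ) : Type := EuclideanSpace ℝ (Fin k)

/-- A family `𝒞` of subsets of `α` shatters the finite set `s` if every subset of `s` is the
trace on `s` of a member of `𝒞`. -/
def SetShatters {α : Type*} (𝒞 : Set (Set α)) (s : Finset α) : Prop :=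
  ∀ t : Finset α, t ⊆ s → ∃ u ∈ 𝒞, (s : Set α) ∩ u = (t : Set α)

/-- The Vapnik-Chervonenkis dimension of a (possibly infinite) family of sets: the supremum of
the cardinalities of the finite sets that it shatters. -/
noncomputable def setVCDim {α : Type*} (𝒞 : Set (Set α)) : ℕ∞ :=
  ⨆ (s : Finset α) (_ : SetShatters 𝒞 s), (s.card : ℕ∞)

/-- "`p` holds with confidence at least `c`": some event of probability at least `c` is contained
in `{ω | p ω}`. For a measurable `{ω | p ω}` this says that its probability is at least `c`;
otherwise it is the stronger reading of that inequality (inner probability). -/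
def HoldsWithConfidence {Ω : Type*} [MeasurableSpace Ω] (μ : Measure Ω) (c : ℝ)
    (p : Ω → Prop) : Prop :=
  ∃ G : Set Ω, MeasurableSet G ∧ c ≤ μ.real G ∧ ∀ ω ∈ G, p ω

section Barrier

variable {n m q : ℕ} {D : Set (Vec q)}

/-- The parameter box `[-U, U]ᵐ`. -/
def paramBox (m : ℕ) (U : ℝ) : Set (Vec m) := {a | ∀ l, a l ∈ Set.Icc (-U) U}

/-- The set of disturbances at which the barrier condition at the state `x` is violated:
`{d | h(a, f(x,d)) - γ h(a,x) < 0}`. -/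
def violationSet (f : Vec n × D → Vec n) (h : Vec m → Vec n → ℝ) (γ : ℝ) (x : Vec n)
    (a : Vec m) : Set D :=
  {d | h a (f (x, d)) - γ * h a x < 0}

/-- The class of violation indicators at the state `x`, each indicator function being identified
with the set that it indicates. -/
def violationClass (f : Vec n × D → Vec n) (h : Vec m → Vec n → ℝ) (γ U : ℝ) (x : Vec n) :
    Set (Set D) :=
  violationSet f h γ x '' paramBox m U

/-- The feasible set of the sample-based robust barrier program with samples `ds`. -/
def feasibleSet (X Xhat : Set (Vec n)) (f : Vec n × D → Vec n) (h : Vec m → Vec n → ℝ)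
    (γ U : ℝ) {M : ℕ} (ds : Fin M → D) : Set (Vec m) :=
  {a | (∀ x ∈ closure (Xhat \ X), h a x ≤ 0) ∧
       (∀ j, ∀ x ∈ X, γ * h a x ≤ h a (f (x, ds j))) ∧
       a ∈ paramBox m U}

/-- The objective `-(1/Nₒ) ∑ᵢ h(a, x'ᵢ)` of the program. -/
noncomputable def objective (h : Vec m → Vec n → ℝ) {No : ℕ} (x' : Fin No → Vec n)
    (a : Vec m) : ℝ :=
  -((1 / (No : ℝ)) * ∑ i, h a (x' i))

/-- `a` is a globally or locally optimal solution of the sample-based robust barrier program. -/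
def IsOptimalSolution (X Xhat : Set (Vec n)) (f : Vec n × D → Vec n) (h : Vec m → Vec n → ℝ)
    (γ U : ℝ) {No : ℕ} (x' : Fin No → Vec n) {M : ℕ} (ds : Fin M → D) (a : Vec m) : Prop :=
  a ∈ feasibleSet X Xhat f h γ U ds ∧
    (IsMinOn (objective h x') (feasibleSet X Xhat f h γ U ds) a ∨
      IsLocalMinOn (objective h x') (feasibleSet X Xhat f h γ U ds) a)

/-- The set `{x ∈ X | h(a,x) > 0}`. -/
def certifiedSet (X : Set (Vec n)) (h : Vec m → Vec n → ℝ) (a : Vec m) : Set (Vec n) :=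
  {x | x ∈ X ∧ 0 < h a x}

open Classical in
/-- The state-dependent threshold: `ε` on `Xs`, and `1` elsewhere. -/
noncomputable def epsilonAt (Xs : Set (Vec n)) (ε : ℝ) (x : Vec n) : ℝ :=
  if x ∈ Xs then ε else 1

end Barrier

open scoped ENNReal
open Finset

/-! Feasibility forces the violation set of `aStar ds` at `x` to miss every sample point, so the
claim is a PAC bound for consistent hypotheses. Let `A` be the event that this set nevertheless has
mass at least `ε`. Given a ghost sample `v`, integrate the weight `1_A(u) ∏ᵢ (1 + 1[vᵢ ∈ C u])`. By
independence the integral is at least `P^M(A) (1 + ε)^M`. Averaged over coordinatewise swaps of `(u,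
v)`, each trace of the class contributes at most `1`, and Sauer–Shelah counts the traces
(`measure_consistent_mul_le`). The product weight replaces the usual Chebyshev step on the ghost
sample; the sample size then makes the quotient at most `δ`. -/

/-- Pulling a family of sets back along an indexed sample gives a finite family of at most
`∑ k ≤ N, (card κ).choose k` traces if the family has VC dimension at most `N`. -/
theorem exists_traces_card_le {α κ : Type*} [Fintype κ] [DecidableEq κ] (𝒞 : Set (Set α)) (N : ℕ)
    (hN : setVCDim 𝒞 ≤ N) (w : κ → α) :
    ∃ 𝒯 : Finset (Finset κ), (∀ C ∈ 𝒞, ∃ T ∈ 𝒯, ∀ k, k ∈ T ↔ w k ∈ C) ∧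
      #𝒯 ≤ ∑ k ∈ Iic N, (Fintype.card κ).choose k := by
  classical
  let 𝒯 : Finset (Finset κ) := univ.filter fun T => ∃ C ∈ 𝒞, ∀ k, k ∈ T ↔ w k ∈ C
  refine ⟨𝒯, fun C hC => ⟨univ.filter fun k => w k ∈ C, ?_, by simp⟩, ?_⟩
  · simp only [𝒯, mem_filter, mem_univ, true_and]
    exact ⟨C, hC, fun _ => Iff.rfl⟩
  have hdim : 𝒯.vcDim ≤ N := by
    refine Finset.sup_le fun s hs => ?_
    rw [mem_shatterer] at hs
    -- Indices carrying the same point lie in the same traces, so a shattered index set cannot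
    -- contain two of them.
    have hinj : Set.InjOn w s := by
      intro i hi j hj hij
      obtain ⟨T, hT, hsT⟩ := hs.exists_inter_eq_singleton hi
      obtain ⟨C, -, hC⟩ := (mem_filter.1 hT).2
      have hiT : i ∈ T := (mem_inter.1 (hsT ▸ mem_singleton_self i)).2
      have hjT : j ∈ T := (hC j).2 (hij ▸ (hC i).1 hiT)
      exact (mem_singleton.1 (hsT ▸ mem_inter.2 ⟨hj, hjT⟩)).symm
    have hsh : SetShatters 𝒞 (s.image w) := by
      intro t ht
      obtain ⟨T, hT, hsT⟩ := hs (filter_subset (fun k => w k ∈ t) s)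
      obtain ⟨C, hC, hCT⟩ := (mem_filter.1 hT).2
      refine ⟨C, hC, Set.ext fun y => ?_⟩
      have key : ∀ k ∈ s, (w k ∈ C ↔ w k ∈ t) := fun k hk => by
        have := congrArg (k ∈ ·) hsT
        simp only [mem_inter, mem_filter, hk, true_and, eq_iff_iff] at this
        rw [← hCT, this]
      constructor
      · rintro ⟨hy, hyC⟩
        obtain ⟨k, hk, rfl⟩ := mem_image.1 (mem_coe.1 hy)
        exact (key k hk).1 hyC
      · intro hy
        obtain ⟨k, hk, rfl⟩ := mem_image.1 (ht hy)
        exact ⟨mem_coe.2 (mem_image_of_mem _ hk), (key k hk).2 hy⟩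
    have h1 : ((s.image w).card : ℕ∞) ≤ setVCDim 𝒞 :=
      le_iSup₂ (f := fun (s : Finset α) (_ : SetShatters 𝒞 s) => (s.card : ℕ∞)) _ hsh
    rw [card_image_of_injOn hinj] at h1
    exact_mod_cast h1.trans hN
  calc #𝒯 ≤ #𝒯.shatterer := card_le_card_shatterer _
    _ ≤ ∑ k ∈ Iic 𝒯.vcDim, (Fintype.card κ).choose k := card_shatterer_le_sum_vcDim
    _ ≤ _ := sum_le_sum_of_subset (Iic_subset_Iic.2 hdim)

/-! ### Symmetrization over a ghost sample -/

/-- The swap of the components of a pair that is switched on by `b`. -/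
def swapIf {α : Type*} (b : Bool) (p : α × α) : α × α := if b then p.swap else p

theorem measurePreserving_swapIf {α : Type*} [MeasurableSpace α] (P : Measure α)
    [IsProbabilityMeasure P] (b : Bool) :
    MeasurePreserving (swapIf b) (P.prod P) (P.prod P) := by
  cases b
  · exact MeasurePreserving.id _
  · exact Measure.measurePreserving_swap

/-- Symmetrization: the integral of a function of a double sample is bounded by any bound on its
averages over the coordinatewise swaps. -/
theorem lintegral_le_of_sum_swap_le {α ι : Type*} [MeasurableSpace α] [Fintype ι]
    [DecidableEq ι] (P : Measure α) [IsProbabilityMeasure P] (F : (ι → α × α) → ℝ≥0∞)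
    (hF : Measurable F) (S : ℝ≥0∞)
    (hS : ∀ z : ι → α × α, ∑ σ : ι → Bool, F (fun i => swapIf (σ i) (z i)) ≤ 2 ^ Fintype.card ι * S) :
    ∫⁻ z, F z ∂(Measure.pi fun _ : ι => P.prod P) ≤ S := by
  have hmp (σ : ι → Bool) := measurePreserving_pi (fun _ : ι => P.prod P) (fun _ => P.prod P)
    (fun i => measurePreserving_swapIf P (σ i))
  have h1 : ∑ σ : ι → Bool, ∫⁻ z, F (fun i => swapIf (σ i) (z i))
      ∂(Measure.pi fun _ : ι => P.prod P) ≤ 2 ^ Fintype.card ι * S := by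
    have hm (σ : ι → Bool) : Measurable fun z : ι → α × α => F fun i => swapIf (σ i) (z i) :=
      hF.comp (hmp σ).measurable
    rw [← lintegral_finsetSum _ fun σ _ => hm σ]
    refine (lintegral_mono hS).trans ?_
    simp
  simp_rw [fun σ => (hmp σ).lintegral_comp hF] at h1
  simp only [sum_const, card_univ, Fintype.card_fun, Fintype.card_bool, nsmul_eq_mul,
    Nat.cast_pow, Nat.cast_ofNat] at h1
  exact (ENNReal.mul_le_mul_iff_right (by simp) (by simp)).1 h1

open Classical in
/-- Over all coordinatewise swaps of a double sample, a data-dependent member of a family of VC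
dimension at most `N` that misses the first half is bounded by the number of traces. -/
theorem sum_swap_le {α ι : Type*} [Fintype ι] (𝒞 : Set (Set α)) (N : ℕ)
    (hN : setVCDim 𝒞 ≤ N) (A : Set (ι → α)) (C : (ι → α) → Set α) (hC : ∀ u ∈ A, C u ∈ 𝒞)
    (hA : ∀ u ∈ A, ∀ i, u i ∉ C u) (z : ι → α × α) :
    ∑ σ : ι → Bool, (fun y : ι → α × α => if (fun i => (y i).1) ∈ A then
        ∏ i, (1 + if (y i).2 ∈ C (fun i => (y i).1) then (1 : ℝ≥0∞) else 0) else 0)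
        (fun i => swapIf (σ i) (z i)) ≤
      2 ^ Fintype.card ι *
        ((∑ k ∈ Iic N, (2 * Fintype.card ι).choose k : ℕ) : ℝ≥0∞) := by
  let w : ι × Bool → α := fun k => if k.2 then (z k.1).2 else (z k.1).1
  obtain ⟨𝒯, h𝒯, hcard⟩ := exists_traces_card_le 𝒞 N hN w
  -- The value `0` encodes consistency with the first half. The two orientations of a pair sum to
  -- `2` if at most one of its points lies in `T`, and to `0` otherwise.
  let g : Finset (ι × Bool) → ι → Bool → ℝ≥0∞ := fun T i b =>
    if (i, b) ∈ T then 0 else 1 + if (i, !b) ∈ T then 1 else 0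
  have hfst (b : Bool) (i : ι) : (swapIf b (z i)).1 = w (i, b) := by
    cases b <;> simp [swapIf, w]
  have hsnd (b : Bool) (i : ι) : (swapIf b (z i)).2 = w (i, !b) := by
    cases b <;> simp [swapIf, w]
  calc _ ≤ ∑ σ : ι → Bool, ∑ T ∈ 𝒯, ∏ i, g T i (σ i) := by
        refine sum_le_sum fun σ _ => ?_
        simp only [hfst, hsnd]
        split_ifs with hu
        · obtain ⟨T, hT, hTC⟩ := h𝒯 _ (hC _ hu)
          refine le_trans (le_of_eq (prod_congr rfl fun i _ => ?_))
            (single_le_sum (f := fun T => ∏ i, g T i (σ i)) (fun _ _ => zero_le) hT)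
          have := hA _ hu i
          simp only [g, hTC, if_neg this]
        · exact zero_le
    _ = ∑ T ∈ 𝒯, ∏ i, ∑ b, g T i b := by
        rw [sum_comm]
        refine sum_congr rfl fun T _ => ?_
        rw [Fintype.prod_sum]
    _ ≤ ∑ T ∈ 𝒯, ∏ _i : ι, 2 := by
        refine sum_le_sum fun T _ => prod_le_prod' fun i _ => ?_
        simp only [Fintype.sum_bool, g, Bool.not_true, Bool.not_false]
        split_ifs <;> norm_num
    _ ≤ _ := by
        rw [sum_const, prod_const, nsmul_eq_mul, mul_comm, card_univ]
        gcongr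
        simpa [mul_comm] using hcard

/-- A data-dependent member of a family of VC dimension at most `N` that misses all the sample
points is unlikely to have probability at least `ε`. -/
theorem measure_consistent_mul_le {α ι : Type*} [MeasurableSpace α] [Fintype ι]
    (P : Measure α) [IsProbabilityMeasure P] (𝒞 : Set (Set α)) (N : ℕ)
    (hN : setVCDim 𝒞 ≤ N) (A : Set (ι → α)) (hAm : MeasurableSet A) (C : (ι → α) → Set α)
    (hCm : MeasurableSet {p : (ι → α) × α | p.2 ∈ C p.1}) (hC : ∀ u ∈ A, C u ∈ 𝒞)
    (hA : ∀ u ∈ A, ∀ i, u i ∉ C u) (ε : ℝ≥0∞) (hε : ∀ u ∈ A, ε ≤ P (C u)) :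
    Measure.pi (fun _ : ι => P) A * (1 + ε) ^ Fintype.card ι ≤
      ((∑ k ∈ Iic N, (2 * Fintype.card ι).choose k : ℕ) : ℝ≥0∞) := by
  classical
  let G : (ι → α) × (ι → α) → ℝ≥0∞ := fun p => if p.1 ∈ A then
    ∏ i, (1 + if p.2 i ∈ C p.1 then (1 : ℝ≥0∞) else 0) else 0
  have hterm (i : ι) : Measurable fun p : (ι → α) × (ι → α) =>
      (1 + if p.2 i ∈ C p.1 then (1 : ℝ≥0∞) else 0) := by
    refine (measurable_const (a := (1 : ℝ≥0∞))).add (Measurable.ite ?_ measurable_const measurable_const)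
    exact hCm.preimage (f := fun p : (ι → α) × (ι → α) => (p.1, p.2 i)) (by fun_prop)
  have hG : Measurable G := Measurable.ite (hAm.preimage measurable_fst)
    (Finset.measurable_prod _ fun i _ => hterm i) measurable_const
  have hmp := measurePreserving_arrowProdEquivProdArrow α α ι (fun _ => P) (fun _ => P)
  refine le_trans ?_ (lintegral_le_of_sum_swap_le P _ (hG.comp hmp.measurable) _
    (sum_swap_le 𝒞 N hN A C hC hA))
  simp only [Function.comp_def]
  rw [hmp.lintegral_comp hG, lintegral_prod _ hG.aemeasurable]
  rw [mul_comm, ← setLIntegral_const, ← lintegral_indicator hAm]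
  refine lintegral_mono fun u => ?_
  by_cases hu : u ∈ A
  · simp only [Set.indicator_of_mem hu, G, if_pos hu]
    have hCu : MeasurableSet (C u) := hCm.preimage (f := fun y => (u, y)) (by fun_prop)
    have hm1 : Measurable fun y => (1 + if y ∈ C u then (1 : ℝ≥0∞) else 0) :=
      (measurable_const (a := (1 : ℝ≥0∞))).add
        (Measurable.ite (p := (· ∈ C u)) hCu measurable_const measurable_const)
    have hind := ProbabilityTheory.iIndepFun_pi (μ := fun _ : ι => P)
      (X := fun _ y => (1 + if y ∈ C u then (1 : ℝ≥0∞) else 0)) fun _ => hm1.aemeasurable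
    rw [ProbabilityTheory.lintegral_prod_eq_prod_lintegral_of_indepFun univ _ hind
      fun i => hm1.comp (measurable_pi_apply i)]
    have hint (i : ι) : ∫⁻ v : ι → α, (1 + if v i ∈ C u then (1 : ℝ≥0∞) else 0)
        ∂(Measure.pi fun _ => P) = 1 + P (C u) := by
      rw [(measurePreserving_eval (fun _ : ι => P) i).lintegral_comp hm1,
        lintegral_add_left measurable_const]
      congr 1
      · simp
      · rw [← lintegral_indicator_one hCu]
        rfl
    simp only [hint, prod_const, card_univ]
    gcongr
    exact hε u hu
  · simp [hu]

/-! ### Numerical estimates -/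

/-- Since `x ≤ 1`, each term with `k ≤ N` can be inflated by `x⁻ᴺ xᵏ ≥ 1`; the binomial theorem and
`1 + x ≤ exp x` finish. -/
theorem sum_choose_le_exp (N n : ℕ) (x : ℝ) (hx : 0 < x) (hx1 : x ≤ 1) :
    ((∑ k ∈ Iic N, n.choose k : ℕ) : ℝ) ≤ Real.exp (N * Real.log (1 / x) + n * x) := by
  have hexp : Real.exp (N * Real.log (1 / x) + n * x) = (1 / x) ^ N * Real.exp x ^ n := by
    rw [Real.exp_add, ← Real.log_pow, Real.exp_log (by positivity), ← Real.exp_nat_mul]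
  have hone : 1 ≤ 1 / x := (one_le_div hx).2 hx1
  calc ((∑ k ∈ Iic N, n.choose k : ℕ) : ℝ)
      = ∑ k ∈ Iic N, (n.choose k : ℝ) := by push_cast; rfl
    _ ≤ ∑ k ∈ Iic N, (1 / x) ^ N * (x ^ k * (n.choose k : ℝ)) := by
        refine sum_le_sum fun k hk => ?_
        have : (1 : ℝ) ≤ (1 / x) ^ N * x ^ k := by
          calc (1 : ℝ) = (1 / x) ^ k * x ^ k := by
                rw [← mul_pow, one_div_mul_cancel hx.ne', one_pow]
            _ ≤ _ := by gcongr; exacts [mem_Iic.1 hk]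
        rw [← mul_assoc]
        exact le_mul_of_one_le_left (by positivity) this
    _ = (1 / x) ^ N * ∑ k ∈ Iic N, x ^ k * (n.choose k : ℝ) := by rw [mul_sum]
    _ ≤ (1 / x) ^ N * (x + 1) ^ n := by
        gcongr
        rw [add_pow]
        simp only [one_pow, mul_one]
        -- Either index range may be the larger one, hence the union; binomials beyond `n` vanish.
        calc _ ≤ ∑ k ∈ Iic N ∪ range (n + 1), x ^ k * (n.choose k : ℝ) :=
              sum_le_sum_of_subset_of_nonneg subset_union_left fun _ _ _ => by positivity
          _ = _ := by
              symm
              refine sum_subset subset_union_right fun k _ hk => ?_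
              rw [Nat.choose_eq_zero_of_lt (by simpa [Nat.lt_succ_iff] using hk)]
              simp
    _ ≤ (1 / x) ^ N * Real.exp x ^ n := by
        gcongr
        exact Real.add_one_le_exp x
    _ = _ := hexp.symm

/-- With `x = ε / 40` the exponent is at most `εM/5 + εM/20 - log (1/δ)`, which leaves slack below
`εM/2 - log (1/δ)`. -/
theorem sum_choose_le_of_sample_size (N M : ℕ) (ε δ : ℝ) (hε : ε ∈ Set.Ioo (0 : ℝ) 1)
    (hδ : δ ∈ Set.Ioo (0 : ℝ) 1)
    (hM : 5 / ε * (Real.log (4 / δ) + N * Real.log (40 / ε)) ≤ (M : ℝ)) :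
    ((∑ k ∈ Iic N, (2 * M).choose k : ℕ) : ℝ) ≤ δ * (1 + ε) ^ M := by
  obtain ⟨hε0, hε1⟩ := hε
  obtain ⟨hδ0, hδ1⟩ := hδ
  -- From `exp t ≤ 1 / (1 - t)` at `t = ε / 2`, and `(1 + ε)(1 - ε / 2) ≥ 1` for `ε ≤ 1`.
  have hbase : Real.exp (ε / 2) ≤ 1 + ε := by
    have h1 := Real.exp_bound_div_one_sub_of_interval (x := ε / 2) (by linarith) (by linarith)
    refine h1.trans ?_
    rw [div_le_iff₀ (by linarith)]
    nlinarith
  have hM' : Real.log (4 / δ) + N * Real.log (40 / ε) ≤ ε * M / 5 := by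
    rw [div_mul_eq_mul_div, div_le_iff₀ hε0] at hM
    linarith
  have hlog4 : Real.log (1 / δ) ≤ Real.log (4 / δ) :=
    Real.log_le_log (by positivity) (by gcongr; norm_num)
  refine (sum_choose_le_exp N (2 * M) (ε / 40) (by positivity) (by linarith)).trans ?_
  calc Real.exp (N * Real.log (1 / (ε / 40)) + ((2 * M : ℕ) : ℝ) * (ε / 40))
      ≤ Real.exp (-Real.log (1 / δ) + M * (ε / 2)) := by
        rw [Real.exp_le_exp, one_div_div]
        push_cast
        have : (0 : ℝ) ≤ ε * M := by positivity
        linarith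
    _ = δ * Real.exp (ε / 2) ^ M := by
        rw [Real.exp_add, ← Real.log_inv, one_div, inv_inv, Real.exp_log hδ0, Real.exp_nat_mul]
    _ ≤ _ := by gcongr

/-! ### PAC bound and the barrier program -/

/-- PAC bound for data-dependent sets that are consistent with the sample. -/
theorem measureReal_consistent_le {α : Type*} [MeasurableSpace α]
    (P : Measure α) [IsProbabilityMeasure P] (𝒞 : Set (Set α)) (N M : ℕ)
    (hN : setVCDim 𝒞 ≤ N) (ε δ : ℝ) (hε : ε ∈ Set.Ioo (0 : ℝ) 1)
    (hδ : δ ∈ Set.Ioo (0 : ℝ) 1)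
    (hM : 5 / ε * (Real.log (4 / δ) + N * Real.log (40 / ε)) ≤ (M : ℝ))
    (A : Set (Fin M → α)) (hAm : MeasurableSet A) (C : (Fin M → α) → Set α)
    (hCm : MeasurableSet {p : (Fin M → α) × α | p.2 ∈ C p.1}) (hC : ∀ u ∈ A, C u ∈ 𝒞)
    (hA : ∀ u ∈ A, ∀ i, u i ∉ C u) (hAε : ∀ u ∈ A, ε ≤ P.real (C u)) :
    (Measure.pi fun _ : Fin M => P).real A ≤ δ := by
  have h1 := measure_consistent_mul_le P 𝒞 N hN A hAm C hCm hC hA (ENNReal.ofReal ε)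
    fun u hu => ENNReal.ofReal_le_of_le_toReal (hAε u hu)
  have h2 := ENNReal.toReal_mono (by simp) h1
  rw [Fintype.card_fin, ENNReal.toReal_mul, ENNReal.toReal_pow,
    ENNReal.toReal_add (by simp) (by simp), ENNReal.toReal_ofReal hε.1.le, ENNReal.toReal_one,
    ENNReal.toReal_natCast] at h2
  have h3 := h2.trans (sum_choose_le_of_sample_size N M ε δ hε hδ hM)
  have hpos : 0 < (1 + ε) ^ M := by have := hε.1; positivity
  exact le_of_mul_le_mul_right h3 hpos

theorem mainTheorem1
    {n m q : ℕ}
    -- disturbance space and distribution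
    (D : Set (Vec q)) (hD : IsCompact D)
    (P : Measure D) [IsProbabilityMeasure P]
    -- dynamics
    (f : Vec n × D → Vec n) (hf : Continuous f)
    -- safe set, and a compact set containing it and its one-step successors
    (X Xhat : Set (Vec n)) (hX : IsCompact X) (hXhat : IsCompact Xhat)
    (hXX : X ⊆ Xhat) (hfX : ∀ x ∈ X, ∀ d : D, f (x, d) ∈ Xhat)
    -- parametrized barrier functions
    (h : Vec m → Vec n → ℝ) (hh : Measurable (Function.uncurry h)) (h0 : ∀ x, h 0 x = 0)
    -- constants
    (γ ε δ U : ℝ) (hγ : γ ∈ Set.Ioo (0 : ℝ) 1) (hε : ε ∈ Set.Ioo (0 : ℝ) 1)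
    (hδ : δ ∈ Set.Ioo (0 : ℝ) 1) (hU : 0 < U)
    -- sample states in the objective
    {No : ℕ} (hNo : 0 < No) (x' : Fin No → Vec n) (hx' : ∀ i, x' i ∈ X)
    -- uniformly bounded VC dimension
    (N : ℕ) (hVC : ∀ x ∈ X, setVCDim (violationClass f h γ U x) ≤ (N : ℕ∞))
    -- sample size
    (M : ℕ) (hM : 5 / ε * (Real.log (4 / δ) + N * Real.log (40 / ε)) ≤ (M : ℝ))
    -- optimal solution, as a random vector
    (aStar : (Fin M → D) → Vec m)
    (haStar : AEMeasurable aStar (Measure.pi fun _ : Fin M => P))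
    (hopt : ∀ ds, IsOptimalSolution X Xhat f h γ U x' ds (aStar ds)) :
    ∀ x ∈ X,
      HoldsWithConfidence (Measure.pi fun _ : Fin M => P) (1 - δ) (fun ds =>
        (certifiedSet X h (aStar ds)).Nonempty →
          1 - ε ≤ P.real {d | h (aStar ds) (f (x, d)) ≥ γ * h (aStar ds) x}) ∧
      HoldsWithConfidence (Measure.pi fun _ : Fin M => P) (1 - δ) (fun ds =>
        (certifiedSet X h (aStar ds)).Nonempty →
          1 - epsilonAt (certifiedSet X h (aStar ds)) ε x ≤
            P.real {d | f (x, d) ∈ certifiedSet X h (aStar ds)}) := by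
  intro x hx
  set μ := Measure.pi fun _ : Fin M => P
  -- The bad event is built from a measurable version of `aStar`, to be measurable itself; the null
  -- set where they differ is discarded as `Z`.
  let a' := haStar.mk aStar
  have ha' : Measurable a' := haStar.measurable_mk
  let C : (Fin M → D) → Set D := fun ds => violationSet f h γ x (a' ds)
  have hCm : MeasurableSet {p : (Fin M → D) × D | p.2 ∈ C p.1} := by
    have hm1 : Measurable fun p : (Fin M → D) × D => h (a' p.1) (f (x, p.2)) :=
      hh.comp ((ha'.comp measurable_fst).prodMk
        ((hf.comp (by fun_prop : Continuous fun d : D => (x, d))).measurable.comp measurable_snd))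
    have hm2 : Measurable fun p : (Fin M → D) × D => h (a' p.1) x :=
      hh.comp ((ha'.comp measurable_fst).prodMk measurable_const)
    exact measurableSet_lt (hm1.sub (hm2.const_mul γ)) measurable_const
  have hbox : MeasurableSet (paramBox m U) := by
    have : paramBox m U = ⋂ l, {a : Vec m | a l ∈ Set.Icc (-U) U} := by
      ext a; simp [paramBox]
    rw [this]
    exact MeasurableSet.iInter fun l =>
      measurableSet_Icc.preimage (by fun_prop : Measurable fun a : Vec m => a l)
  -- Box membership and consistency are imposed explicitly, since `a'` may be infeasible on the null
  -- set.
  let A : Set (Fin M → D) :=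
    (a' ⁻¹' paramBox m U ∩ ⋂ i, {u | u i ∉ C u}) ∩ {u | ε ≤ P.real (C u)}
  have hAm : MeasurableSet A := by
    refine ((hbox.preimage ha').inter (MeasurableSet.iInter fun i => ?_)).inter ?_
    · exact (hCm.preimage (f := fun u : Fin M → D => (u, u i)) (by fun_prop)).compl
    · exact measurableSet_le measurable_const (measurable_measure_prodMk_left hCm).ennreal_toReal
  have hA : μ.real A ≤ δ := by
    refine measureReal_consistent_le P (violationClass f h γ U x) N M (hVC x hx) ε δ hε hδ hM
      A hAm C hCm (fun u hu => ⟨a' u, hu.1.1, rfl⟩) (fun u hu => Set.mem_iInter.1 hu.1.2)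
      (fun u hu => hu.2)
  obtain ⟨Z, hZsub, hZm, hZ⟩ := exists_measurable_superset_of_null (ae_iff.1 haStar.ae_eq_mk)
  have hG : MeasurableSet (A ∪ Z)ᶜ := (hAm.union hZm).compl
  have hGμ : 1 - δ ≤ μ.real (A ∪ Z)ᶜ := by
    rw [probReal_compl_eq_one_sub (hAm.union hZm)]
    have := measureReal_union_le (μ := μ) A Z
    have hZ0 : μ.real Z = 0 := by simp [Measure.real, hZ]
    linarith
  have hgood : ∀ ds ∈ (A ∪ Z)ᶜ,
      1 - ε ≤ P.real {d | h (aStar ds) (f (x, d)) ≥ γ * h (aStar ds) x} := by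
    intro ds hds
    have hds' : ds ∉ A ∧ ds ∉ Z := by simpa using hds
    have heq : aStar ds = a' ds := by
      by_contra hne
      exact hds'.2 (hZsub hne)
    obtain ⟨-, hsample, hin⟩ := (hopt ds).1
    have hlt : P.real (C ds) < ε := by
      by_contra! hle
      refine hds'.1 ⟨⟨show a' ds ∈ _ from heq ▸ hin, Set.mem_iInter.2 fun i => ?_⟩, hle⟩
      have := hsample i x hx
      rw [heq] at this
      simp only [C, violationSet, Set.mem_ofPred_eq, not_lt]
      linarith
    have hCd : MeasurableSet (C ds) := hCm.preimage (f := fun d => (ds, d)) (by fun_prop)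
    have hset : {d : D | h (aStar ds) (f (x, d)) ≥ γ * h (aStar ds) x} = (C ds)ᶜ := by
      ext d
      simp [C, violationSet, heq]
    rw [hset, probReal_compl_eq_one_sub hCd]
    linarith
  refine ⟨⟨_, hG, hGμ, fun ds hds _ => hgood ds hds⟩, ⟨_, hG, hGμ, fun ds hds _ => ?_⟩⟩
  by_cases hxs : x ∈ certifiedSet X h (aStar ds)
  · rw [epsilonAt, if_pos hxs]
    refine (hgood ds hds).trans (measureReal_mono fun d hd => ?_)
    have hpos : 0 < h (aStar ds) (f (x, d)) := (mul_pos hγ.1 hxs.2).trans_le hd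
    refine ⟨?_, hpos⟩
    -- A successor in `Xhat \ X` would have `h ≤ 0` by the first constraint.
    by_contra hnX
    exact absurd ((hopt ds).1.1 _ (subset_closure ⟨hfX x hx d, hnX⟩)) (not_le.2 hpos)
  · rw [epsilonAt, if_neg hxs, sub_self]
    exact measureReal_nonneg
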